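/- A \emph{Coxeter diagram} consists of a finite set $V$ of vertices and, for each pair of distinct vertices $i,j$, a multiplicity $m_{ij}=m_{ji}\in\{0,1,2,3\}$; if $m_{ij}>0$ the vertices are said to be joined by a line of multiplicity $m_{ij}$. It is \emph{connected} if $V\neq\emptyset$ and any two vertices are joined by a path of lines. A \emph{Cartan matrix} is an integer matrix $A=(A_{ij})$ with $A_{ii}=2$ and, for $i\ne j$, $A_{ij}\le 0$, $A_{ij}A_{ji}\in\{0,1,2,3\}$, and $A_{ji}=0$ whenever $A_{ij}=0$. A \emph{symmetrised Cartan matrix} is a real symmetric matrix $B$ of the form $B_{ij}=c_iA_{ij}c_j^{-1}$ with $A$ a Cartan matrix and all $c_i>0$. It \emph{generates} the Coxeter diagram with the multiplicities $m_{ij}=B_{ij}^2$ ($i\neq j$). A Coxeter diagram is \emph{positive definite} if it is generated by a positive definite symmetrised Cartan matrix. \textbf{Theorem.} Up to isomorphism (bijections of the vertices preserving multiplicities), the positive definite connected Coxeter diagrams are exactly the following, where $l$ is the number of vertices and all lines have multiplicity $1$ unless stated otherwise: - $A_l$, $l\ge 1$: the chain with lines $\{i,i+1\}$, $1\le i<l$;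 - $B_l/C_l$, $l\ge 2$: the same chain, with $\{1,2\}$ of multiplicity $2$; - $D_l$, $l\ge 4$: lines $\{1,3\}$, $\{2,3\}$, and $\{i,i+1\}$ for $3\le i<l$; - $E_l$, $6\le l\le 8$: lines $\{1,2\}$, $\{2,4\}$, $\{3,4\}$, and $\{i,i+1\}$ for $4\le i<l$; - $F_4$: the chain on $4$ vertices with $\{2,3\}$ of multiplicity $2$; - $G_2$: two vertices joined by a line of multiplicity $3$. The same classification holds if "positive definite" is taken to mean that the real matrix with entries $2$ on the diagonal and $-\sqrt{m_{ij}}$ off it is positive definite. -/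

import Mathlib

/-- A Cartan matrix in the general sense: an integer matrix with diagonal entries `2`, non-positive
off-diagonal entries, zeros in symmetric positions, and `A i j * A j i ∈ {0, 1, 2, 3}` for
`i ≠ j`. -/
structure IsCartanMatrix {V : Type*} (A : Matrix V V ℤ) : Prop where
  diag : ∀ i, A i i = 2
  nonpos : ∀ i j, i ≠ j → A i j ≤ 0
  zero_symm : ∀ i j, i ≠ j → A i j = 0 → A j i = 0
  mul_nonneg : ∀ i j, i ≠ j → 0 ≤ A i j * A j i
  mul_le_three : ∀ i j, i ≠ j → A i j * A j i ≤ 3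

/-- `B` is a symmetrised Cartan matrix: it is symmetric, and `B i j = c i * A i j / c j` for some
Cartan matrix `A` and some positive real numbers `c i`. -/
def IsSymmetrisedCartanMatrix {V : Type*} (B : Matrix V V ℝ) : Prop :=
  B.IsSymm ∧ ∃ A : Matrix V V ℤ, IsCartanMatrix A ∧
    ∃ c : V → ℝ, (∀ i, 0 < c i) ∧ ∀ i j, B i j = c i * (A i j : ℝ) * (c j)⁻¹

/-- A Coxeter diagram with vertex set `V`: each pair of distinct vertices is joined by a line of
multiplicity `1`, `2` or `3`, or by no line (multiplicity `0`). -/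
structure CoxeterDiagram (V : Type*) where
  /-- The multiplicity of the line between two vertices. -/
  mult : V → V → ℕ
  symm : ∀ i j, mult i j = mult j i
  self : ∀ i, mult i i = 0
  le_three : ∀ i j, mult i j ≤ 3

namespace CoxeterDiagram

/-- The simple graph underlying a Coxeter diagram. -/
def graph {V : Type*} (Γ : CoxeterDiagram V) : SimpleGraph V :=
  SimpleGraph.fromRel fun i j => Γ.mult i j ≠ 0

/-- A Coxeter diagram is connected if it has a vertex and any two vertices are joined by a path of
lines. -/
def Connected {V : Type*} (Γ : CoxeterDiagram V) : Prop :=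
  Γ.graph.Connected

/-- The diagram `Γ` is generated by the matrix `B`: the line between `i ≠ j` has multiplicity
`(B i j) ^ 2`. -/
def GeneratedBy {V : Type*} (Γ : CoxeterDiagram V) (B : Matrix V V ℝ) : Prop :=
  ∀ i j, i ≠ j → (Γ.mult i j : ℝ) = B i j ^ 2

/-- A Coxeter diagram is positive definite if it is generated by a positive definite symmetrised
Cartan matrix. -/
def IsPosDef {V : Type*} (Γ : CoxeterDiagram V) : Prop :=
  ∃ B : Matrix V V ℝ, IsSymmetrisedCartanMatrix B ∧ Γ.GeneratedBy B ∧ B.PosDef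

/-- The real symmetric matrix with entries `2` on the diagonal and `-√(mult i j)` off it. -/
noncomputable def symmMatrix {V : Type*} [DecidableEq V] (Γ : CoxeterDiagram V) : Matrix V V ℝ :=
  Matrix.of fun i j => if i = j then 2 else -√(Γ.mult i j : ℝ)

/-- An isomorphism of Coxeter diagrams is a bijection of the vertices that preserves
multiplicities. -/
def Isomorphic {V W : Type*} (Γ : CoxeterDiagram V) (Δ : CoxeterDiagram W) : Prop :=
  ∃ e : V ≃ W, ∀ i j, Δ.mult (e i) (e j) = Γ.mult i j

/-- The Coxeter diagram on the vertices `0, …, l - 1` in which `i < j` are joined by a line of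
multiplicity `m i j`. -/
def ofUpper (l : ℕ) (m : ℕ → ℕ → ℕ) (hm : ∀ i j, m i j ≤ 3) : CoxeterDiagram (Fin l) where
  mult i j := if i < j then m i j else if j < i then m j i else 0
  symm i j := by
    rcases lt_trichotomy i j with h | h | h
    · simp [h, h.not_gt]
    · simp [h]
    · simp [h, h.not_gt]
  self i := by simp
  le_three i j := by
    split_ifs
    · exact hm _ _
    · exact hm _ _
    · exact Nat.zero_le _

/-- The chain `0 - 1 - 2 - ⋯` of `l` vertices. -/
def typeA (l : ℕ) : CoxeterDiagram (Fin l) :=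
  ofUpper l (fun i j => if j = i + 1 then 1 else 0) (by intro i j; split_ifs <;> simp)

/-- The chain `0 = 1 - 2 - ⋯` of `l` vertices, whose first line is double. -/
def typeBC (l : ℕ) : CoxeterDiagram (Fin l) :=
  ofUpper l (fun i j => if j = i + 1 then (if i = 0 then 2 else 1) else 0)
    (by intro i j; split_ifs <;> simp)

/-- The diagram `(0, 1) > 2 - 3 - ⋯` of `l` vertices. -/
def typeD (l : ℕ) : CoxeterDiagram (Fin l) :=
  ofUpper l (fun i j => if (i = 0 ∧ j = 2) ∨ (1 ≤ i ∧ j = i + 1) then 1 else 0)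
    (by intro i j; split_ifs <;> simp)

/-- The diagram `(0 - 1, 2) > 3 - 4 - ⋯` of `l` vertices. -/
def typeE (l : ℕ) : CoxeterDiagram (Fin l) :=
  ofUpper l
    (fun i j => if (i = 0 ∧ j = 1) ∨ (i = 1 ∧ j = 3) ∨ (2 ≤ i ∧ j = i + 1) then 1 else 0)
    (by intro i j; split_ifs <;> simp)

/-- The chain `0 - 1 = 2 - 3`. -/
def typeF4 : CoxeterDiagram (Fin 4) :=
  ofUpper 4 (fun i j => if j = i + 1 then (if i = 1 then 2 else 1) else 0)
    (by intro i j; split_ifs <;> simp)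

/-- The diagram of two vertices joined by a triple line. -/
def typeG2 : CoxeterDiagram (Fin 2) :=
  ofUpper 2 (fun i j => if j = i + 1 then 3 else 0) (by intro i j; split_ifs <;> simp)

/-- `Γ` is one of the diagrams `A_l` (`l ≥ 1`), `B_l/C_l` (`l ≥ 2`), `D_l` (`l ≥ 4`),
`E_l` (`6 ≤ l ≤ 8`), `F_4`, `G_2`, up to isomorphism. -/
def IsClassified {V : Type*} (Γ : CoxeterDiagram V) : Prop :=
  (∃ l, 1 ≤ l ∧ Γ.Isomorphic (typeA l)) ∨
  (∃ l, 2 ≤ l ∧ Γ.Isomorphic (typeBC l)) ∨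
  (∃ l, 4 ≤ l ∧ Γ.Isomorphic (typeD l)) ∨
  (∃ l, 6 ≤ l ∧ l ≤ 8 ∧ Γ.Isomorphic (typeE l)) ∨
  Γ.Isomorphic typeF4 ∨
  Γ.Isomorphic typeG2

end CoxeterDiagram

/-! A symmetrised Cartan matrix has diagonal 2 and non-positive entries elsewhere, and the
multiplicities fix the squares of the latter. The only one that can generate `Γ` is therefore
`symmMatrix`, and both versions of the theorem concern the single form `quad`. The Cartan condition
matters only for the listed diagrams, where a two-colouring of the vertices by root length provides
it.

The listed diagrams are positive definite because each matrix M admits a positive vector v with Mv ≥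
0 and Mv ≠ 0 (`posDef_of_pos_vector`); v is a null vector of an affine diagram, restricted to a part
of it.

Conversely, the indicator of a path has form value at most 2. Adding the outside vertices with
optimal coefficients shows that the lines from a path to vertices outside it have total multiplicity
at most 3 (`sum_mult_le_three`). Applied to segments of a longest path, this forbids chords, two
multiple lines, and two vertices attached to the path. The remaining freedom is in the position of a
multiple line and in the arm lengths. Null vectors of the affine diagrams of types F4, E6, E7 and E8
bound these, and only the list survives. -/

open Finset Matrix

namespace CoxeterDiagram

/-! ### The quadratic form of a diagram -/

section QuadraticForm

variable {V : Type*} (Γ : CoxeterDiagram V)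

/-- The square root of the multiplicity of the line between two vertices. -/
noncomputable def weight (i j : V) : ℝ := √(Γ.mult i j : ℝ)

theorem weight_nonneg (i j : V) : 0 ≤ Γ.weight i j := Real.sqrt_nonneg _

theorem weight_symm (i j : V) : Γ.weight i j = Γ.weight j i := by
  rw [weight, weight, Γ.symm]

@[simp] theorem weight_self (i : V) : Γ.weight i i = 0 := by
  simp [weight, Γ.self]

theorem weight_sq (i j : V) : Γ.weight i j ^ 2 = Γ.mult i j :=
  Real.sq_sqrt (Nat.cast_nonneg _)

theorem one_le_weight {i j : V} (h : Γ.mult i j ≠ 0) : 1 ≤ Γ.weight i j := by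
  rw [weight, Real.one_le_sqrt]
  exact_mod_cast Nat.one_le_iff_ne_zero.2 h

theorem graph_adj {i j : V} : Γ.graph.Adj i j ↔ Γ.mult i j ≠ 0 := by
  simp only [graph, SimpleGraph.fromRel_adj, Γ.symm j i, or_self]
  refine ⟨fun h => h.2, fun h => ⟨?_, h⟩⟩
  rintro rfl
  exact h (Γ.self i)

/-- The diagram induced on the domain of a map into the vertices. -/
def comap {ι : Type*} (g : ι → V) : CoxeterDiagram ι where
  mult i j := Γ.mult (g i) (g j)
  symm _ _ := Γ.symm _ _
  self _ := Γ.self _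
  le_three _ _ := Γ.le_three _ _

theorem symmMatrix_apply [DecidableEq V] (i j : V) :
    Γ.symmMatrix i j = (if i = j then 2 else 0) - Γ.weight i j := by
  by_cases h : i = j
  · simp [symmMatrix, h]
  · simp [symmMatrix, h, weight]

theorem symmMatrix_isSymm [DecidableEq V] : Γ.symmMatrix.IsSymm := by
  ext i j
  simp [symmMatrix_apply, Γ.weight_symm j i, eq_comm]

theorem symmMatrix_comap [DecidableEq V] {ι : Type*} [DecidableEq ι] {g : ι → V}
    (hg : Function.Injective g) :
    (Γ.comap g).symmMatrix = Γ.symmMatrix.submatrix g g := by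
  ext i j
  simp [symmMatrix_apply, hg.eq_iff, weight, comap]

variable [Fintype V]

/-- The quadratic form of the matrix `Γ.symmMatrix`. -/
noncomputable def quad (x : V → ℝ) : ℝ :=
  2 * ∑ i, x i ^ 2 - ∑ i, ∑ j, Γ.weight i j * x i * x j

theorem dotProduct_symmMatrix_mulVec [DecidableEq V] (x : V → ℝ) :
    x ⬝ᵥ Γ.symmMatrix *ᵥ x = Γ.quad x := by
  simp only [dotProduct, mulVec, symmMatrix_apply, quad, mul_sum, ← sum_sub_distrib]
  refine sum_congr rfl fun i _ => ?_
  simp only [sub_mul, ite_mul, zero_mul, mul_sub, sum_sub_distrib, mul_ite, mul_zero,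
    sum_ite_eq, mem_univ, if_true]
  congr 1
  · ring
  · exact sum_congr rfl fun j _ => by ring

theorem posDef_symmMatrix_iff [DecidableEq V] :
    Γ.symmMatrix.PosDef ↔ ∀ x, x ≠ 0 → 0 < Γ.quad x := by
  rw [posDef_iff_dotProduct_mulVec]
  simp only [star_trivial, dotProduct_symmMatrix_mulVec]
  refine ⟨fun h x hx => h.2 hx, fun h => ⟨?_, fun x hx => h x hx⟩⟩
  rw [IsHermitian, conjTranspose_eq_transpose_of_trivial]
  exact Γ.symmMatrix_isSymm

/-- The cross term is grouped by the coordinates of `z`, so that for `x` the indicator of a set each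
of them multiplies the total weight of the lines into that set. -/
theorem quad_add (x z : V → ℝ) :
    Γ.quad (x + z) = Γ.quad x + Γ.quad z + 4 * ∑ i, x i * z i
      - 2 * ∑ i, z i * ∑ j, Γ.weight i j * x j := by
  have h : ∑ i, ∑ j, Γ.weight i j * x i * z j = ∑ i, z i * ∑ j, Γ.weight i j * x j := by
    rw [sum_comm]
    refine sum_congr rfl fun i _ => ?_
    rw [mul_sum]
    exact sum_congr rfl fun j _ => by rw [Γ.weight_symm]; ring
  have h' : ∑ i, ∑ j, Γ.weight i j * z i * x j = ∑ i, z i * ∑ j, Γ.weight i j * x j := by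
    refine sum_congr rfl fun i _ => ?_
    rw [mul_sum]
    exact sum_congr rfl fun j _ => by ring
  have h₁ : ∑ i, ∑ j, Γ.weight i j * (x i + z i) * (x j + z j)
      = ∑ i, ∑ j, Γ.weight i j * x i * x j + ∑ i, ∑ j, Γ.weight i j * z i * z j
        + 2 * ∑ i, z i * ∑ j, Γ.weight i j * x j := by
    rw [two_mul]
    nth_rw 1 [← h]
    rw [← h']
    simp only [← sum_add_distrib]
    exact sum_congr rfl fun i _ => sum_congr rfl fun j _ => by ring
  have h₂ : ∑ i, (x i + z i) ^ 2 = ∑ i, x i ^ 2 + ∑ i, z i ^ 2 + 2 * ∑ i, x i * z i := by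
    simp only [mul_sum, ← sum_add_distrib]
    exact sum_congr rfl fun i _ => by ring
  simp only [quad, Pi.add_apply, h₁, h₂]
  ring

theorem quad_le_of_nonneg {x : V → ℝ} (hx : 0 ≤ x) : Γ.quad x ≤ 2 * ∑ i, x i ^ 2 := by
  rw [quad, sub_le_self_iff]
  exact sum_nonneg fun i _ => sum_nonneg fun j _ =>
    mul_nonneg (mul_nonneg (Γ.weight_nonneg _ _) (hx i)) (hx j)

omit [Fintype V] in
/-- Substituting smaller weights into the form of a subdiagram keeps it positive on non-negative
vectors. -/
theorem pos_of_le_weight [DecidableEq V] (hΓ : Γ.symmMatrix.PosDef) {ι : Type*} [Fintype ι]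
    {g : ι → V} (hg : Function.Injective g) {N : ι → ι → ℝ}
    (hN : ∀ a b, N a b ≤ Γ.weight (g a) (g b)) {y : ι → ℝ} (hy : 0 ≤ y) (hy0 : y ≠ 0) :
    0 < 2 * ∑ a, y a ^ 2 - ∑ a, ∑ b, N a b * y a * y b := by
  classical
  have h := hΓ.submatrix hg
  rw [← Γ.symmMatrix_comap hg, posDef_symmMatrix_iff] at h
  refine (h y hy0).trans_le (sub_le_sub_left (sum_le_sum fun a _ => sum_le_sum fun b _ => ?_) _)
  exact mul_le_mul_of_nonneg_right (mul_le_mul_of_nonneg_right (hN a b) (hy a)) (hy b)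

/-- A connected diagram is positive definite if its matrix maps some positive vector to a non-zero
vector with non-negative coordinates. -/
theorem posDef_of_pos_vector [DecidableEq V] (hc : Γ.Connected) {v : V → ℝ} (hv : ∀ i, 0 < v i)
    (h : ∀ i, ∑ j, Γ.weight i j * v j ≤ 2 * v i) {k : V}
    (hk : ∑ j, Γ.weight k j * v j < 2 * v k) : Γ.symmMatrix.PosDef := by
  rw [posDef_symmMatrix_iff]
  intro x hx
  obtain ⟨y, rfl⟩ : ∃ y : V → ℝ, x = fun i => v i * y i :=
    ⟨fun i => x i / v i, funext fun i => by rw [mul_div_cancel₀ _ (hv i).ne']⟩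
  set r : V → ℝ := fun i => 2 * v i - ∑ j, Γ.weight i j * v j with hr
  have hr0 : ∀ i, 0 ≤ r i := fun i => sub_nonneg.2 (h i)
  -- In the coordinates `y = x / v` the form is a sum of squares with non-negative coefficients. If
  -- it vanishes, `y` is constant along lines and zero at `k`, hence zero by connectedness.
  have key : Γ.quad (fun i => v i * y i) = ∑ i, r i * v i * y i ^ 2 +
      1 / 2 * ∑ i, ∑ j, Γ.weight i j * v i * v j * (y i - y j) ^ 2 := by
    have e₁ : ∑ i, ∑ j, Γ.weight i j * v i * v j * (y i - y j) ^ 2 =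
        ∑ i, ∑ j, Γ.weight i j * v i * v j * y i ^ 2
        + ∑ i, ∑ j, Γ.weight i j * v i * v j * y j ^ 2
        - 2 * ∑ i, ∑ j, Γ.weight i j * (v i * y i) * (v j * y j) := by
      simp only [mul_sum, ← sum_add_distrib, ← sum_sub_distrib]
      exact sum_congr rfl fun i _ => sum_congr rfl fun j _ => by ring
    have e₂ : ∑ i, ∑ j, Γ.weight i j * v i * v j * y j ^ 2 =
        ∑ i, ∑ j, Γ.weight i j * v i * v j * y i ^ 2 := by
      rw [sum_comm]
      exact sum_congr rfl fun i _ => sum_congr rfl fun j _ => by rw [Γ.weight_symm]; ring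
    have e₃ : ∑ i, r i * v i * y i ^ 2 = 2 * ∑ i, (v i * y i) ^ 2 -
        ∑ i, ∑ j, Γ.weight i j * v i * v j * y i ^ 2 := by
      rw [mul_sum, ← sum_sub_distrib]
      refine sum_congr rfl fun i _ => ?_
      have : ∑ j, Γ.weight i j * v i * v j * y i ^ 2
          = (∑ j, Γ.weight i j * v j) * (v i * y i ^ 2) := by
        rw [sum_mul]
        exact sum_congr rfl fun j _ => by ring
      rw [this, hr]
      ring
    rw [e₁, e₂, e₃, quad]
    ring
  have t₁ : ∀ i ∈ univ, 0 ≤ r i * v i * y i ^ 2 := fun i _ =>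
    mul_nonneg (mul_nonneg (hr0 i) (hv i).le) (sq_nonneg _)
  have t₂ : ∀ i, ∀ j ∈ univ, 0 ≤ Γ.weight i j * v i * v j * (y i - y j) ^ 2 := fun i j _ =>
    mul_nonneg (mul_nonneg (mul_nonneg (Γ.weight_nonneg _ _) (hv i).le) (hv j).le) (sq_nonneg _)
  have t₃ : ∀ i ∈ univ, 0 ≤ ∑ j, Γ.weight i j * v i * v j * (y i - y j) ^ 2 := fun i _ =>
    sum_nonneg (t₂ i)
  have s₁ := sum_nonneg t₁
  have s₂ := sum_nonneg t₃
  rw [key]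
  by_contra hcon
  have z₁ := (sum_eq_zero_iff_of_nonneg t₁).1 (by linarith)
  have z₂ := (sum_eq_zero_iff_of_nonneg t₃).1 (by linarith)
  have yk : y k = 0 := by
    have := z₁ k (mem_univ _)
    simpa [(hv k).ne', (sub_pos.2 hk).ne', hr] using this
  have hadj : ∀ i j, Γ.graph.Adj i j → y i = y j := by
    intro i j hij
    have := (sum_eq_zero_iff_of_nonneg (t₂ i)).1 (z₂ i (mem_univ _)) j (mem_univ _)
    have hw := one_pos.trans_le (Γ.one_le_weight (Γ.graph_adj.1 hij))
    simpa [(hv i).ne', (hv j).ne', hw.ne', sub_eq_zero] using this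
  apply hx
  funext i
  obtain ⟨p⟩ := hc.preconnected i k
  have : y i = y k := by
    induction p with
    | nil => rfl
    | cons e _ ih => exact (hadj _ _ e).trans (ih hk yk)
  simp [this, yk]

end QuadraticForm

/-! ### Symmetrised Cartan matrices and `symmMatrix` -/

section Symmetrisable

variable {V : Type*}

/-- The predicate `p` separates two root lengths with squared ratio `k`: lines within a class are
simple, and lines between the classes have multiplicity `k`. Scaling by √k on `p` turns the entries
-1 and -k of a line between the classes both into -√k. -/
theorem symmMatrix_isSymmetrised [DecidableEq V] (Γ : CoxeterDiagram V) (p : V → Prop) (k : ℕ)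
    (hk : 1 ≤ k)
    (h₁ : ∀ i j, Γ.mult i j ≠ 0 → (p i ↔ p j) → Γ.mult i j = 1)
    (h₂ : ∀ i j, Γ.mult i j ≠ 0 → p i → ¬ p j → Γ.mult i j = k) :
    IsSymmetrisedCartanMatrix Γ.symmMatrix := by
  classical
  let A : Matrix V V ℤ := fun i j =>
    if i = j then 2 else if Γ.mult i j = 0 then 0 else if ¬ p i ∧ p j then -(k : ℤ) else -1
  have hA : ∀ i j, i ≠ j → A i j * A j i = Γ.mult i j := by
    intro i j hij
    by_cases h0 : Γ.mult i j = 0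
    · simp [A, hij, h0]
    · have h0' : Γ.mult j i ≠ 0 := by rwa [Γ.symm]
      have a := h₁ i j h0
      have b := h₂ i j h0
      have c := h₂ j i h0'
      rw [Γ.symm j i] at c
      by_cases hi : p i <;> by_cases hj : p j <;>
        simp_all [A, hij.symm]
  refine ⟨Γ.symmMatrix_isSymm, A, ⟨?_, ?_, ?_, ?_, ?_⟩, fun i => if p i then √(k : ℝ) else 1,
    ?_, ?_⟩
  · intro i
    simp [A]
  · intro i j hij
    simp only [A, if_neg hij]
    split_ifs <;> omega
  · intro i j hij
    simp only [A, if_neg hij, if_neg hij.symm, Γ.symm j i]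
    intro h
    split_ifs at h ⊢ <;> omega
  · intro i j hij
    rw [hA i j hij]
    positivity
  · intro i j hij
    rw [hA i j hij]
    exact_mod_cast Γ.le_three i j
  · intro i
    dsimp only
    split_ifs
    · exact Real.sqrt_pos.2 (by exact_mod_cast hk)
    · exact one_pos
  · intro i j
    have hs : √(k : ℝ) ≠ 0 := (Real.sqrt_pos.2 (by exact_mod_cast hk)).ne'
    have hss : √(k : ℝ) * √(k : ℝ) = k := Real.mul_self_sqrt (Nat.cast_nonneg _)
    by_cases hij : i = j
    · subst hij
      by_cases hi : p i <;> simp [symmMatrix, A, hi]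
      field_simp
    · by_cases h0 : Γ.mult i j = 0
      · simp [symmMatrix, A, hij, h0]
      · have h0' : Γ.mult j i ≠ 0 := by rwa [Γ.symm]
        have a := h₁ i j h0
        have b := h₂ i j h0
        have c := h₂ j i h0'
        rw [Γ.symm j i] at c
        by_cases hi : p i <;> by_cases hj : p j
        · simp [symmMatrix, A, hij, hi, hj, a (by simp [hi, hj]), hs]
        · simp [symmMatrix, A, hij, hi, hj, b hi hj]
        · have hk0 : k ≠ 0 := by omega
          simp only [symmMatrix, A, hij, hi, hj, hk0, c hj hi, of_apply, if_false, if_true,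
            not_false_eq_true, and_self]
          push_cast
          rw [eq_mul_inv_iff_mul_eq₀ hs]
          linarith
        · simp [symmMatrix, A, hij, hi, hj, a (by simp [hi, hj])]

/-- Conjugation by a positive diagonal matrix keeps the diagonal and the signs of `A`, so `B i j` is
the non-positive square root of the multiplicity and `B` equals `symmMatrix`. -/
theorem symmMatrix_posDef_of_isPosDef [DecidableEq V] {Γ : CoxeterDiagram V} (h : Γ.IsPosDef) :
    Γ.symmMatrix.PosDef := by
  obtain ⟨B, ⟨-, A, hA, c, hc, hB⟩, hΓ, hpos⟩ := h
  convert hpos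
  ext i j
  by_cases hij : i = j
  · subst hij
    simp [symmMatrix, hB, hA.diag]
    field_simp [(hc i).ne']
  · have hA' : (A i j : ℝ) ≤ 0 := by exact_mod_cast hA.nonpos i j hij
    have : B i j ≤ 0 := by
      rw [hB]
      exact mul_nonpos_of_nonpos_of_nonneg (mul_nonpos_of_nonneg_of_nonpos (hc i).le hA')
        (inv_nonneg.2 (hc j).le)
    rw [symmMatrix, of_apply, if_neg hij, hΓ i j hij, Real.sqrt_sq_eq_abs, abs_of_nonpos this,
      neg_neg]

theorem isPosDef_of_symmMatrix [DecidableEq V] {Γ : CoxeterDiagram V}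
    (h : IsSymmetrisedCartanMatrix Γ.symmMatrix) (hpos : Γ.symmMatrix.PosDef) : Γ.IsPosDef := by
  refine ⟨_, h, fun i j hij => ?_, hpos⟩
  simp [symmMatrix, hij]

end Symmetrisable

/-! ### Invariance under isomorphism -/

section Isomorphic

variable {V W : Type*} {Γ : CoxeterDiagram V} {Δ : CoxeterDiagram W}

theorem Isomorphic.connected (h : Γ.Isomorphic Δ) (hΔ : Δ.Connected) : Γ.Connected := by
  obtain ⟨e, he⟩ := h
  let f : Γ.graph ≃g Δ.graph := ⟨e, fun {a b} => by
    show Δ.graph.Adj (e a) (e b) ↔ _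
    rw [graph_adj, graph_adj, he]⟩
  exact f.connected_iff.2 hΔ

theorem Isomorphic.exists_symmMatrix_eq [DecidableEq V] [DecidableEq W] (h : Γ.Isomorphic Δ) :
    ∃ e : V ≃ W, Γ.symmMatrix = Δ.symmMatrix.submatrix e e := by
  obtain ⟨e, he⟩ := h
  refine ⟨e, ?_⟩
  ext i j
  simp [symmMatrix, he]

theorem Isomorphic.posDef_symmMatrix [DecidableEq V] [DecidableEq W] (h : Γ.Isomorphic Δ)
    (hΔ : Δ.symmMatrix.PosDef) : Γ.symmMatrix.PosDef := by
  obtain ⟨e, he⟩ := h.exists_symmMatrix_eq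
  rw [he]
  exact hΔ.submatrix e.injective

theorem Isomorphic.symmetrised [DecidableEq V] [DecidableEq W] (h : Γ.Isomorphic Δ)
    (hΔ : IsSymmetrisedCartanMatrix Δ.symmMatrix) :
    IsSymmetrisedCartanMatrix Γ.symmMatrix := by
  obtain ⟨e, he⟩ := h.exists_symmMatrix_eq
  obtain ⟨-, A, hA, c, hc, hB⟩ := hΔ
  have hne : ∀ {i j}, i ≠ j → e i ≠ e j := fun hij => e.injective.ne hij
  refine ⟨Γ.symmMatrix_isSymm, A.submatrix e e, ⟨fun i => hA.diag _, fun i j hij =>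
    hA.nonpos _ _ (hne hij), fun i j hij => hA.zero_symm _ _ (hne hij), fun i j hij =>
    hA.mul_nonneg _ _ (hne hij), fun i j hij => hA.mul_le_three _ _ (hne hij)⟩, c ∘ e,
    fun i => hc _, fun i j => ?_⟩
  rw [he]
  exact hB _ _

end Isomorphic

/-! ### The listed diagrams are connected, positive definite and symmetrisable -/

section Types

/-- Moving repeatedly to a larger neighbour leads from any vertex to the last one. -/
theorem ofUpper_connected {l : ℕ} {m : ℕ → ℕ → ℕ} {hm : ∀ i j, m i j ≤ 3} (hl : 0 < l)
    (h : ∀ i, i + 1 < l → ∃ j, i < j ∧ j < l ∧ m i j ≠ 0) : (ofUpper l m hm).Connected := by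
  let z : Fin l := ⟨l - 1, by omega⟩
  have key : ∀ d, ∀ i : Fin l, (i : ℕ) + d + 1 = l → (ofUpper l m hm).graph.Reachable i z := by
    intro d
    induction d using Nat.strong_induction_on with
    | _ d ih =>
      intro i hi
      rcases Nat.eq_zero_or_pos d with rfl | hd
      · have : i = z := Fin.ext (by simp only [z]; omega)
        rw [this]
      · obtain ⟨j, hij, hjl, hj⟩ := h i (by omega)
        have hadj : (ofUpper l m hm).graph.Adj i ⟨j, hjl⟩ := by
          rw [graph_adj]
          have : i < ⟨j, hjl⟩ := hij
          simpa [ofUpper, this] using hj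
        exact hadj.reachable.trans (ih (l - 1 - j) (by omega) ⟨j, hjl⟩ (by simp only; omega))
  have : Nonempty (Fin l) := ⟨z⟩
  exact ⟨fun i j => (key (l - 1 - i) i (by omega)).trans (key (l - 1 - j) j (by omega)).symm⟩

/-- The set `s` may contain numbers beyond `l`, since superfluous terms are non-negative. Thus one
list of potential neighbours serves inner vertices and the end of a chain alike. -/
theorem ofUpper_sum_weight_le {l : ℕ} {m : ℕ → ℕ → ℕ} {hm : ∀ i j, m i j ≤ 3} {v : ℕ → ℝ}
    (hv : ∀ i, 0 < v i) (i : Fin l) (s : Finset ℕ)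
    (hs : ∀ j < l, (if (i : ℕ) < j then m i j else if j < i then m j i else 0) ≠ 0 → j ∈ s) :
    ∑ j, (ofUpper l m hm).weight i j * v j ≤
      ∑ j ∈ s, √((if (i : ℕ) < j then m i j else if j < i then m j i else 0 : ℕ) : ℝ) * v j := by
  set F : ℕ → ℝ := fun j =>
    √((if (i : ℕ) < j then m i j else if j < i then m j i else 0 : ℕ) : ℝ) * v j with hF
  have h₁ : ∀ j : Fin l, (ofUpper l m hm).weight i j * v j = F j := fun j => by
    simp [F, weight, ofUpper]
  have h₂ : ∀ j, 0 ≤ F j := fun j => mul_nonneg (Real.sqrt_nonneg _) (hv j).le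
  rw [sum_congr rfl fun j _ => h₁ j, Fin.sum_univ_eq_sum_range F l,
    ← sum_filter_of_ne (p := fun j => j ∈ s)]
  · refine sum_le_sum_of_subset_of_nonneg (fun j hj => (mem_filter.1 hj).2) fun j _ _ => h₂ j
  · intro j hj hne
    have hjl := mem_range.1 hj
    refine hs j hjl fun h0 => hne ?_
    simp only [F, h0]
    simp

theorem typeA_connected {l : ℕ} (hl : 1 ≤ l) : (typeA l).Connected :=
  ofUpper_connected hl fun i hi => ⟨i + 1, by omega, hi, by simp⟩

theorem typeBC_connected {l : ℕ} (hl : 2 ≤ l) : (typeBC l).Connected :=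
  ofUpper_connected (by omega) fun i hi => ⟨i + 1, by omega, hi, by by_cases h : i = 0 <;> simp [h]⟩

theorem typeD_connected {l : ℕ} (hl : 4 ≤ l) : (typeD l).Connected := by
  refine ofUpper_connected (by omega) fun i hi => ?_
  rcases Nat.eq_zero_or_pos i with rfl | h
  · exact ⟨2, by omega, by omega, by simp⟩
  · exact ⟨i + 1, by omega, hi, by simp; omega⟩

theorem typeE_connected {l : ℕ} (hl : 6 ≤ l) : (typeE l).Connected := by
  refine ofUpper_connected (by omega) fun i hi => ?_
  rcases Nat.lt_or_ge i 2 with h | h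
  · rcases (by omega : i = 0 ∨ i = 1) with rfl | rfl
    · exact ⟨1, by omega, by omega, by simp⟩
    · exact ⟨3, by omega, by omega, by simp⟩
  · exact ⟨i + 1, by omega, hi, by simp; omega⟩

theorem typeF4_connected : typeF4.Connected :=
  ofUpper_connected (by omega) fun i hi => ⟨i + 1, by omega, hi, by by_cases h : i = 1 <;> simp [h]⟩

theorem typeG2_connected : typeG2.Connected :=
  ofUpper_connected (by omega) fun i hi => ⟨i + 1, by omega, hi, by simp⟩

theorem typeA_posDef {l : ℕ} (hl : 1 ≤ l) : (typeA l).symmMatrix.PosDef := by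
  have h0 : ∀ i : Fin l, (i : ℕ) = 0 → ∑ j, (typeA l).weight i j * 1 ≤ 1 := by
    intro i hi
    refine (ofUpper_sum_weight_le (v := fun _ => 1) (fun _ => one_pos) i {1} fun j hj => ?_).trans ?_
    · simp only [hi, mem_singleton]
      split_ifs <;> omega
    · simp [hi]
  refine posDef_of_pos_vector _ (typeA_connected hl) (v := fun _ => 1) (fun _ => one_pos) ?_
    (k := ⟨0, hl⟩) ((h0 _ rfl).trans_lt (by norm_num))
  intro i
  rcases Nat.eq_zero_or_pos i with hi | hi
  · exact (h0 i hi).trans (by norm_num)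
  · obtain ⟨k, hk⟩ : ∃ k, (i : ℕ) = k + 1 := ⟨i - 1, by omega⟩
    refine (ofUpper_sum_weight_le (v := fun _ => 1) (fun _ => one_pos) i {k, k + 2}
      fun j hj => ?_).trans ?_
    · simp only [hk, mem_insert, mem_singleton]
      split_ifs <;> omega
    · simp [hk]
      norm_num

theorem typeBC_posDef {l : ℕ} (hl : 2 ≤ l) : (typeBC l).symmMatrix.PosDef := by
  have h2 : √(2 : ℝ) * √2 = 2 := Real.mul_self_sqrt (by norm_num)
  have h2' : 0 < √(2 : ℝ) := by positivity
  -- This is a null vector of the chain continued indefinitely; cutting the chain creates the strict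
  -- inequality at the last vertex.
  set v : ℕ → ℝ := fun i => if i = 0 then √2 / 2 else 1 with hv
  have hv0 : ∀ i, 0 < v i := fun i => by
    simp only [v]
    split_ifs <;> positivity
  refine posDef_of_pos_vector _ (typeBC_connected hl) (v := fun i => v i) (fun i => hv0 i) ?_
    (k := ⟨l - 1, by omega⟩) ?_
  · intro i
    rcases Nat.eq_zero_or_pos i with hi | hi
    · refine (ofUpper_sum_weight_le hv0 i {1} fun j hj => ?_).trans ?_
      · simp only [hi, mem_singleton]
        split_ifs <;> omega
      · simp [hi, v]
        linarith
    · obtain ⟨k, hk⟩ : ∃ k, (i : ℕ) = k + 1 := ⟨i - 1, by omega⟩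
      refine (ofUpper_sum_weight_le hv0 i {k, k + 2} fun j hj => ?_).trans ?_
      · simp only [hk, mem_insert, mem_singleton]
        split_ifs <;> omega
      · rcases Nat.eq_zero_or_pos k with rfl | hk0
        · simp [hk, v]
          linarith
        · simp [hk, v, hk0.ne']
          norm_num
  · obtain ⟨k, rfl⟩ : ∃ k, l = k + 2 := ⟨l - 2, by omega⟩
    refine (ofUpper_sum_weight_le hv0 _ {k} fun j hj => ?_).trans_lt ?_
    · simp only [mem_singleton]
      split_ifs <;> omega
    · rcases Nat.eq_zero_or_pos k with rfl | hk0
      · simp [v]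
        linarith
      · simp [v, hk0.ne']

theorem typeD_posDef {l : ℕ} (hl : 4 ≤ l) : (typeD l).symmMatrix.PosDef := by
  set v : ℕ → ℝ := fun i => if i < 2 then 1 / 2 else 1 with hv
  have hv0 : ∀ i, 0 < v i := fun i => by
    simp only [v]
    split_ifs <;> positivity
  refine posDef_of_pos_vector _ (typeD_connected hl) (v := fun i => v i) (fun i => hv0 i) ?_
    (k := ⟨l - 1, by omega⟩) ?_
  · intro i
    rcases (by omega : (i : ℕ) = 0 ∨ (i : ℕ) = 1 ∨ (i : ℕ) = 2 ∨ 3 ≤ (i : ℕ))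
      with hi | hi | hi | hi
    · refine (ofUpper_sum_weight_le hv0 i {2} fun j hj => ?_).trans ?_
      · simp only [hi, mem_singleton]
        split_ifs <;> omega
      · simp [hi, v]
    · refine (ofUpper_sum_weight_le hv0 i {2} fun j hj => ?_).trans ?_
      · simp only [hi, mem_singleton]
        split_ifs <;> omega
      · simp [hi, v]
    · refine (ofUpper_sum_weight_le hv0 i {0, 1, 3} fun j hj => ?_).trans ?_
      · simp only [hi, mem_insert, mem_singleton]
        split_ifs <;> omega
      · simp [hi, v]
        norm_num
    · obtain ⟨k, hk⟩ : ∃ k, (i : ℕ) = k + 3 := ⟨i - 3, by omega⟩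
      refine (ofUpper_sum_weight_le hv0 i {k + 2, k + 4} fun j hj => ?_).trans ?_
      · simp only [hk, mem_insert, mem_singleton]
        split_ifs <;> omega
      · simp [hk, v]
        norm_num
  · obtain ⟨k, rfl⟩ : ∃ k, l = k + 4 := ⟨l - 4, by omega⟩
    refine (ofUpper_sum_weight_le hv0 _ {k + 2} fun j hj => ?_).trans_lt ?_
    · simp only [mem_singleton]
      split_ifs <;> omega
    · simp [v]

theorem typeE_posDef {l : ℕ} (hl : 6 ≤ l) (hl' : l ≤ 8) : (typeE l).symmMatrix.PosDef := by
  have hc := typeE_connected hl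
  -- These are the marks 2, 4, 3, 6, 5, 4, 3, 2 of affine E8 without its extending vertex.
  -- Truncation to `l` vertices only lowers neighbour sums, and at the last vertex the slack is 9 -
  -- l > 0.
  set v : ℕ → ℝ := fun i => if i = 0 then 2 else if i = 1 then 4 else if i = 2 then 3 else 9 - i
    with hv
  have hv0 : ∀ i : Fin l, 0 < v i := fun i => by
    have : ((i : ℕ) : ℝ) ≤ 7 := by exact_mod_cast (by omega : (i : ℕ) ≤ 7)
    simp only [v]
    split_ifs <;> linarith
  refine posDef_of_pos_vector _ hc (v := fun i => v i) hv0 ?_ (k := ⟨l - 1, by omega⟩) ?_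
  · intro i
    interval_cases l <;> fin_cases i <;>
      simp [Fin.sum_univ_succ, typeE, ofUpper, weight, v] <;> norm_num
  · interval_cases l <;>
      simp [Fin.sum_univ_succ, typeE, ofUpper, weight, v] <;> norm_num

theorem typeF4_posDef : typeF4.symmMatrix.PosDef := by
  have h2 : √(2 : ℝ) * √2 = 2 := Real.mul_self_sqrt (by norm_num)
  have h2' : 0 < √(2 : ℝ) := by positivity
  -- This is the null vector from `not_affineF4` without its last coordinate.
  refine posDef_of_pos_vector _ typeF4_connected (v := ![√2, 2 * √2, 3, 2]) ?_ ?_ (k := 3) ?_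
  · intro i
    fin_cases i <;> simp
  · intro i
    fin_cases i <;> simp [Fin.sum_univ_succ, typeF4, ofUpper, weight] <;> linarith
  · simp [Fin.sum_univ_succ, typeF4, ofUpper, weight]
    norm_num

theorem typeG2_posDef : typeG2.symmMatrix.PosDef := by
  have h3 : √(3 : ℝ) * √3 = 3 := Real.mul_self_sqrt (by norm_num)
  refine posDef_of_pos_vector _ typeG2_connected (v := ![√3, 2]) ?_ ?_ (k := 1) ?_
  · intro i
    fin_cases i <;> simp
  · intro i
    fin_cases i <;> simp [Fin.sum_univ_succ, typeG2, ofUpper, weight] <;> linarith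
  · simp [Fin.sum_univ_succ, typeG2, ofUpper, weight]
    linarith

theorem symmetrised_of_mult_le_one {V : Type*} [DecidableEq V] (Γ : CoxeterDiagram V)
    (h : ∀ i j, Γ.mult i j ≤ 1) : IsSymmetrisedCartanMatrix Γ.symmMatrix :=
  Γ.symmMatrix_isSymmetrised (fun _ => False) 1 le_rfl
    (fun i j h0 _ => by have := h i j; omega) (fun _ _ _ h0 => h0.elim)

theorem typeA_symmetrised (l : ℕ) : IsSymmetrisedCartanMatrix (typeA l).symmMatrix :=
  symmetrised_of_mult_le_one _ fun i j => by simp only [typeA, ofUpper]; split_ifs <;> omega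

theorem typeD_symmetrised (l : ℕ) : IsSymmetrisedCartanMatrix (typeD l).symmMatrix :=
  symmetrised_of_mult_le_one _ fun i j => by simp only [typeD, ofUpper]; split_ifs <;> omega

theorem typeE_symmetrised (l : ℕ) : IsSymmetrisedCartanMatrix (typeE l).symmMatrix :=
  symmetrised_of_mult_le_one _ fun i j => by simp only [typeE, ofUpper]; split_ifs <;> omega

theorem typeBC_symmetrised (l : ℕ) : IsSymmetrisedCartanMatrix (typeBC l).symmMatrix := by
  refine symmMatrix_isSymmetrised _ (fun i => (i : ℕ) = 0) 2 (by norm_num) ?_ ?_ <;>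
  · intro i j
    simp only [typeBC, ofUpper, Fin.lt_def]
    split_ifs <;> omega

theorem typeF4_symmetrised : IsSymmetrisedCartanMatrix typeF4.symmMatrix := by
  refine symmMatrix_isSymmetrised _ (fun i => (i : ℕ) ≤ 1) 2 (by norm_num) ?_ ?_ <;>
  · intro i j
    simp only [typeF4, ofUpper, Fin.lt_def]
    split_ifs <;> omega

theorem typeG2_symmetrised : IsSymmetrisedCartanMatrix typeG2.symmMatrix := by
  refine symmMatrix_isSymmetrised _ (fun i => (i : ℕ) = 0) 3 (by norm_num) ?_ ?_ <;>
  · intro i j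
    simp only [typeG2, ofUpper, Fin.lt_def]
    split_ifs <;> omega

theorem IsClassified.connected_symmetrised_posDef {V : Type*} [DecidableEq V]
    {Γ : CoxeterDiagram V} (h : Γ.IsClassified) :
    Γ.Connected ∧ IsSymmetrisedCartanMatrix Γ.symmMatrix ∧ Γ.symmMatrix.PosDef := by
  rcases h with ⟨l, hl, h⟩ | ⟨l, hl, h⟩ | ⟨l, hl, h⟩ | ⟨l, hl, hl', h⟩ | h | h
  · exact ⟨h.connected (typeA_connected hl), h.symmetrised (typeA_symmetrised l),
      h.posDef_symmMatrix (typeA_posDef hl)⟩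
  · exact ⟨h.connected (typeBC_connected hl), h.symmetrised (typeBC_symmetrised l),
      h.posDef_symmMatrix (typeBC_posDef hl)⟩
  · exact ⟨h.connected (typeD_connected hl), h.symmetrised (typeD_symmetrised l),
      h.posDef_symmMatrix (typeD_posDef hl)⟩
  · exact ⟨h.connected (typeE_connected hl), h.symmetrised (typeE_symmetrised l),
      h.posDef_symmMatrix (typeE_posDef hl hl')⟩
  · exact ⟨h.connected typeF4_connected, h.symmetrised typeF4_symmetrised,
      h.posDef_symmMatrix typeF4_posDef⟩
  · exact ⟨h.connected typeG2_connected, h.symmetrised typeG2_symmetrised,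
      h.posDef_symmMatrix typeG2_posDef⟩

end Types

/-! ### Paths and the lines leaving them -/

section Paths

variable {V : Type*} {Γ : CoxeterDiagram V}

/-- The indicator function of a finite set of vertices. -/
noncomputable def ind [DecidableEq V] (P : Finset V) : V → ℝ := fun i => if i ∈ P then 1 else 0

theorem sum_weight_ind [Fintype V] [DecidableEq V] (P : Finset V) (i : V) :
    ∑ j, Γ.weight i j * ind P j = ∑ p ∈ P, Γ.weight i p := by
  simp [ind]

/-- A vertex u outside P with coefficient t changes the form by at most 2t² - 2at, where a is its
total weight into P; lines inside U only lower the form. The minimum -a²/2 is at t = a/2, so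
positivity gives 0 < 2 - ∑ a²/2. -/
theorem sum_sq_weight_lt_four [Fintype V] [DecidableEq V] (hΓ : Γ.symmMatrix.PosDef)
    {P U : Finset V} (hP : P.Nonempty) (hq : Γ.quad (ind P) ≤ 2) (hd : Disjoint P U) :
    ∑ u ∈ U, (∑ p ∈ P, Γ.weight u p) ^ 2 < 4 := by
  set a : V → ℝ := fun u => ∑ p ∈ P, Γ.weight u p with ha
  have ha0 : ∀ u, 0 ≤ a u := fun u => sum_nonneg fun p _ => Γ.weight_nonneg _ _
  set z : V → ℝ := fun u => if u ∈ U then a u / 2 else 0 with hz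
  have hz0 : 0 ≤ z := fun u => by
    simp only [z, Pi.zero_apply]
    split_ifs
    · exact div_nonneg (ha0 u) zero_le_two
    · exact le_rfl
  have hPz : ∀ i, ind P i * z i = 0 := fun i => by
    by_cases hi : i ∈ P
    · simp [z, disjoint_left.1 hd hi]
    · simp [ind, hi]
  obtain ⟨p, hp⟩ := hP
  have hne : ind P + z ≠ 0 := fun h => by
    have h1 := congrFun h p
    have h2 := hz0 p
    simp only [Pi.add_apply, ind, hp, if_true, Pi.zero_apply] at h1 h2
    linarith
  have h := (posDef_symmMatrix_iff Γ).1 hΓ _ hne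
  simp only [quad_add, hPz, sum_weight_ind, sum_const_zero] at h
  have h₁ := Γ.quad_le_of_nonneg hz0
  have h₂ : ∑ i, z i ^ 2 = ∑ u ∈ U, a u ^ 2 / 4 := by
    simp only [z, ite_pow, zero_pow two_ne_zero, sum_ite_mem, univ_inter]
    exact sum_congr rfl fun i _ => by ring
  have h₃ : ∑ i, z i * a i = ∑ u ∈ U, a u ^ 2 / 2 := by
    simp only [z, ite_mul, zero_mul, sum_ite_mem, univ_inter]
    exact sum_congr rfl fun i _ => by ring
  have h₄ : ∑ i, z i * ∑ p ∈ P, Γ.weight i p = ∑ u ∈ U, a u ^ 2 / 2 := h₃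
  rw [h₄] at h
  rw [h₂] at h₁
  simp only [← sum_div] at h h₁
  linarith

/-- The multiplicity is the square of the weight, a sum of squares of non-negative numbers is at
most the square of the sum, and an integer below 4 is at most 3. -/
theorem sum_mult_le_three [Fintype V] [DecidableEq V] (hΓ : Γ.symmMatrix.PosDef)
    {P U : Finset V} (hP : P.Nonempty) (hq : Γ.quad (ind P) ≤ 2) (hd : Disjoint P U) :
    ∑ u ∈ U, ∑ p ∈ P, Γ.mult u p ≤ 3 := by
  have h := sum_sq_weight_lt_four hΓ hP hq hd
  have h' : ((∑ u ∈ U, ∑ p ∈ P, Γ.mult u p : ℕ) : ℝ) < 4 := by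
    refine lt_of_le_of_lt ?_ h
    push_cast
    refine sum_le_sum fun u _ => ?_
    rw [sum_congr rfl fun p _ => (Γ.weight_sq u p).symm]
    exact sum_sq_le_sq_sum_of_nonneg fun p _ => Γ.weight_nonneg _ _
  have : ∑ u ∈ U, ∑ p ∈ P, Γ.mult u p < 4 := by exact_mod_cast h'
  omega

/-- The new vertex contributes 2 from the diagonal and minus twice its total weight into P, which is
at least 1. -/
theorem quad_ind_insert_le [Fintype V] [DecidableEq V] {P : Finset V} {v p : V} (hv : v ∉ P)
    (hp : p ∈ P) (h : Γ.mult v p ≠ 0) : Γ.quad (ind (insert v P)) ≤ Γ.quad (ind P) := by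
  have e : ind (insert v P) = ind P + ind {v} := by
    funext i
    by_cases hi : i = v
    · simp [ind, hi, hv]
    · simp [ind, hi]
  have h₁ : Γ.quad (ind {v}) ≤ 2 := by
    refine (Γ.quad_le_of_nonneg fun i => ?_).trans ?_
    · simp only [ind, Pi.zero_apply]
      split_ifs <;> norm_num
    · simp [ind, ite_pow]
  have h₂ : ∑ i, ind P i * ind {v} i = 0 := sum_eq_zero fun i _ => by
    by_cases hi : i = v
    · simp [ind, hi, hv]
    · simp [ind, hi]
  have h₃ : ∑ i, ind {v} i * ∑ j, Γ.weight i j * ind P j = ∑ p ∈ P, Γ.weight v p := by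
    simp [ind]
  have h₄ : 1 ≤ ∑ p ∈ P, Γ.weight v p :=
    (Γ.one_le_weight h).trans (single_le_sum (fun q _ => Γ.weight_nonneg v q) hp)
  rw [e, quad_add, h₂, h₃]
  linarith

/-- The vertices `f 0, …, f (n - 1)` are distinct, and consecutive ones are joined by a line. -/
structure IsLinePath (Γ : CoxeterDiagram V) (n : ℕ) (f : ℕ → V) : Prop where
  inj : ∀ i < n, ∀ j < n, f i = f j → i = j
  adj : ∀ i, i + 1 < n → Γ.mult (f i) (f (i + 1)) ≠ 0

namespace IsLinePath

variable {n : ℕ} {f : ℕ → V}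

theorem reverse (h : Γ.IsLinePath n f) : Γ.IsLinePath n fun i => f (n - 1 - i) := by
  refine ⟨fun i hi j hj hij => ?_, fun i hi => ?_⟩
  · have := h.inj _ (by omega) _ (by omega) hij
    omega
  · have := h.adj (n - 1 - (i + 1)) (by omega)
    rwa [Γ.symm, show n - 1 - (i + 1) + 1 = n - 1 - i by omega] at this

theorem cons (h : Γ.IsLinePath n f) {w : V} (hw : ∀ i < n, f i ≠ w) (hadj : Γ.mult w (f 0) ≠ 0) :
    Γ.IsLinePath (n + 1) fun i => if i = 0 then w else f (i - 1) := by
  refine ⟨fun i hi j hj hij => ?_, fun i hi => ?_⟩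
  · split_ifs at hij with h₁ h₂ h₂
    · omega
    · exact (hw _ (by omega) hij.symm).elim
    · exact (hw _ (by omega) hij).elim
    · have := h.inj _ (by omega) _ (by omega) hij
      omega
  · rcases Nat.eq_zero_or_pos i with rfl | hi0
    · simpa using hadj
    · have := h.adj (i - 1) (by omega)
      rw [show i - 1 + 1 = i by omega] at this
      simpa [hi0.ne'] using this

theorem drop (h : Γ.IsLinePath n f) {m : ℕ} (k : ℕ) (hk : m + k ≤ n) :
    Γ.IsLinePath m fun i => f (i + k) := by
  refine ⟨fun i hi j hj hij => ?_, fun i hi => ?_⟩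
  · have := h.inj _ (by omega) _ (by omega) hij
    omega
  · have := h.adj (i + k) (by omega)
    rwa [show i + k + 1 = i + 1 + k by omega] at this

theorem not_mem_image [DecidableEq V] (h : Γ.IsLinePath n f) {i j k : ℕ} (hj : j < n) (hk : k < n)
    (hk' : k < i ∨ j < k) : f k ∉ (Icc i j).image f := by
  simp only [mem_image, mem_Icc, not_exists, not_and]
  intro a ha hak
  have := h.inj a (by omega) k hk hak
  omega

variable [Fintype V] [DecidableEq V]

theorem quad_ind_image_le (h : Γ.IsLinePath n f) {i j : ℕ} (hij : i ≤ j) (hj : j < n) :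
    Γ.quad (ind ((Icc i j).image f)) ≤ 2 := by
  induction j, hij using Nat.le_induction with
  | base =>
    refine (Γ.quad_le_of_nonneg fun v => ?_).trans ?_
    · simp only [ind, Pi.zero_apply]
      split_ifs <;> norm_num
    · simp [ind, ite_pow]
  | succ j hij ih =>
    refine le_trans ?_ (ih (by omega))
    have e : (Icc i (j + 1)).image f = insert (f (j + 1)) ((Icc i j).image f) := by
      rw [← image_insert]
      congr 1
      ext a
      simp only [mem_insert, mem_Icc]
      omega
    rw [e]
    refine quad_ind_insert_le (h.not_mem_image (by omega) hj (by omega)) (p := f j)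
      (mem_image_of_mem _ (mem_Icc.2 ⟨hij, le_rfl⟩)) ?_
    rw [Γ.symm]
    exact h.adj j hj

/-- Only one chosen line per outside vertex is counted; `κ u` is the position of its endpoint on the
segment. -/
theorem sum_mult_le_three (hΓ : Γ.symmMatrix.PosDef) (h : Γ.IsLinePath n f) {i j : ℕ}
    (hij : i ≤ j) (hj : j < n) {U : Finset V} (hU : ∀ u ∈ U, u ∉ (Icc i j).image f) (κ : V → ℕ)
    (hκ : ∀ u ∈ U, i ≤ κ u ∧ κ u ≤ j) : ∑ u ∈ U, Γ.mult u (f (κ u)) ≤ 3 := by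
  refine le_trans (sum_le_sum fun u hu => ?_) (CoxeterDiagram.sum_mult_le_three hΓ (U := U)
    ⟨f i, mem_image_of_mem _ (mem_Icc.2 ⟨le_rfl, hij⟩)⟩ (h.quad_ind_image_le hij hj)
    (disjoint_right.2 fun {u} hu => hU u hu))
  exact single_le_sum (f := fun p => Γ.mult u p) (fun _ _ => Nat.zero_le _)
    (mem_image_of_mem _ (mem_Icc.2 (hκ u hu)))

theorem mult_add_le_three (hΓ : Γ.symmMatrix.PosDef) (h : Γ.IsLinePath n f) {i j a b : ℕ}
    {u v : V} (hj : j < n) (hu : u ∉ (Icc i j).image f) (hv : v ∉ (Icc i j).image f)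
    (huv : u ≠ v) (ha : i ≤ a) (ha' : a ≤ j) (hb : i ≤ b) (hb' : b ≤ j) :
    Γ.mult u (f a) + Γ.mult v (f b) ≤ 3 := by
  have := h.sum_mult_le_three hΓ (ha.trans ha') hj (U := {u, v})
    (by simpa [forall_eq_or_imp] using ⟨by simpa using hu, by simpa using hv⟩)
    (fun x => if x = u then a else b)
    (fun x _ => by split_ifs <;> omega)
  rw [sum_pair huv] at this
  simpa [huv.symm] using this

theorem mult_add_add_le_three (hΓ : Γ.symmMatrix.PosDef) (h : Γ.IsLinePath n f) {i j a b c : ℕ}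
    {u v w : V} (hj : j < n) (hu : u ∉ (Icc i j).image f) (hv : v ∉ (Icc i j).image f)
    (hw : w ∉ (Icc i j).image f) (huv : u ≠ v) (huw : u ≠ w) (hvw : v ≠ w)
    (ha : i ≤ a) (ha' : a ≤ j) (hb : i ≤ b) (hb' : b ≤ j) (hc : i ≤ c) (hc' : c ≤ j) :
    Γ.mult u (f a) + Γ.mult v (f b) + Γ.mult w (f c) ≤ 3 := by
  have := h.sum_mult_le_three hΓ (ha.trans ha') hj (U := {u, v, w})
    (by
      intro x hx
      simp only [mem_insert, mem_singleton] at hx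
      rcases hx with rfl | rfl | rfl <;> assumption)
    (fun x => if x = u then a else if x = v then b else c)
    (fun x _ => by split_ifs <;> omega)
  rw [sum_insert (by simp [huv, huw]), sum_pair hvw] at this
  simpa [huv.symm, huw.symm, hvw.symm, add_assoc] using this

theorem mult_add_add_add_le_three (hΓ : Γ.symmMatrix.PosDef) (h : Γ.IsLinePath n f)
    {i j a b c d : ℕ} {u v w x : V} (hj : j < n) (hu : u ∉ (Icc i j).image f)
    (hv : v ∉ (Icc i j).image f) (hw : w ∉ (Icc i j).image f) (hx : x ∉ (Icc i j).image f)
    (huv : u ≠ v) (huw : u ≠ w) (hux : u ≠ x) (hvw : v ≠ w) (hvx : v ≠ x) (hwx : w ≠ x)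
    (ha : i ≤ a) (ha' : a ≤ j) (hb : i ≤ b) (hb' : b ≤ j) (hc : i ≤ c) (hc' : c ≤ j)
    (hd : i ≤ d) (hd' : d ≤ j) :
    Γ.mult u (f a) + Γ.mult v (f b) + Γ.mult w (f c) + Γ.mult x (f d) ≤ 3 := by
  have := h.sum_mult_le_three hΓ (ha.trans ha') hj (U := {u, v, w, x})
    (by
      intro y hy
      simp only [mem_insert, mem_singleton] at hy
      rcases hy with rfl | rfl | rfl | rfl <;> assumption)
    (fun y => if y = u then a else if y = v then b else if y = w then c else d)
    (fun y _ => by split_ifs <;> omega)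
  rw [sum_insert (by simp [huv, huw, hux]), sum_insert (by simp [hvw, hvx]), sum_pair hwx] at this
  simpa [huv.symm, huw.symm, hvw.symm, hux.symm, hvx.symm, hwx.symm, add_assoc] using this

/-- Two lines from u into the segment would have total weight at least 2, hence square at least 4.
This is how cycles are excluded. -/
theorem mult_eq_zero_of_mult_ne_zero (hΓ : Γ.symmMatrix.PosDef) (h : Γ.IsLinePath n f)
    {i j a b : ℕ} {u : V} (hj : j < n) (hu : u ∉ (Icc i j).image f) (ha : i ≤ a) (ha' : a ≤ j)
    (hb : i ≤ b) (hb' : b ≤ j) (hab : a ≠ b) (hua : Γ.mult u (f a) ≠ 0) :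
    Γ.mult u (f b) = 0 := by
  by_contra hub
  have hP := sum_sq_weight_lt_four hΓ (U := {u})
    ⟨f a, mem_image_of_mem _ (mem_Icc.2 ⟨ha, ha'⟩)⟩ (h.quad_ind_image_le (ha.trans ha') hj)
    (by simpa using hu)
  have hne : f a ≠ f b := fun e => hab (h.inj _ (by omega) _ (by omega) e)
  have : ∑ p ∈ {f a, f b}, Γ.weight u p ≤ ∑ p ∈ (Icc i j).image f, Γ.weight u p := by
    refine sum_le_sum_of_subset_of_nonneg ?_ fun _ _ _ => Γ.weight_nonneg _ _
    intro p hp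
    simp only [mem_insert, mem_singleton] at hp
    rcases hp with rfl | rfl
    · exact mem_image_of_mem _ (mem_Icc.2 ⟨ha, ha'⟩)
    · exact mem_image_of_mem _ (mem_Icc.2 ⟨hb, hb'⟩)
  rw [sum_pair hne] at this
  rw [sum_singleton] at hP
  have h1 := Γ.one_le_weight hua
  have h2 := Γ.one_le_weight hub
  nlinarith

theorem mult_eq_zero (hΓ : Γ.symmMatrix.PosDef) (h : Γ.IsLinePath n f) {i j : ℕ}
    (hij : i + 2 ≤ j) (hj : j < n) : Γ.mult (f i) (f j) = 0 := by
  rw [Γ.symm]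
  refine h.mult_eq_zero_of_mult_ne_zero hΓ (i := i) (j := j - 1) (a := j - 1) (by omega)
    (h.not_mem_image (by omega) hj (by omega)) (by omega) le_rfl le_rfl (by omega) (by omega) ?_
  have := h.adj (j - 1) (by omega)
  rwa [show j - 1 + 1 = j by omega, Γ.symm] at this

/-- Both lines leave the segment from `f (i + 1)` to `f j`. -/
theorem mult_add_mult_le_three (hΓ : Γ.symmMatrix.PosDef) (h : Γ.IsLinePath n f) {i j : ℕ}
    (hij : i < j) (hj : j + 1 < n) :
    Γ.mult (f i) (f (i + 1)) + Γ.mult (f j) (f (j + 1)) ≤ 3 := by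
  rw [Γ.symm (f j)]
  exact h.mult_add_le_three hΓ (i := i + 1) (j := j) (by omega)
    (h.not_mem_image (by omega) (by omega) (by omega))
    (h.not_mem_image (by omega) (by omega) (by omega))
    (fun e => by have := h.inj _ (by omega) _ (by omega) e; omega)
    le_rfl hij hij le_rfl

end IsLinePath

end Paths

/-! ### Classification by means of a longest path -/

section Classification

variable {V : Type*} {Γ : CoxeterDiagram V}

theorem isomorphic_ofUpper {l : ℕ} {m : ℕ → ℕ → ℕ} {hm : ∀ i j, m i j ≤ 3} (g : ℕ → V)
    (hinj : ∀ i < l, ∀ j < l, g i = g j → i = j) (hsurj : ∀ v, ∃ i < l, g i = v)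
    (h : ∀ i j, i < j → j < l → Γ.mult (g i) (g j) = m i j) :
    Γ.Isomorphic (ofUpper l m hm) := by
  have hb : Function.Bijective fun i : Fin l => g i :=
    ⟨fun i j hij => Fin.ext (hinj i i.2 j j.2 hij), fun v => by
      obtain ⟨i, hi, rfl⟩ := hsurj v
      exact ⟨⟨i, hi⟩, rfl⟩⟩
  have key : ∀ i j : Fin l, (ofUpper l m hm).mult i j = Γ.mult (g i) (g j) := by
    intro i j
    simp only [ofUpper]
    split_ifs with h₁ h₂
    · exact (h i j h₁ j.2).symm
    · rw [Γ.symm]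
      exact (h j i h₂ i.2).symm
    · rw [show i = j from le_antisymm (not_lt.1 h₂) (not_lt.1 h₁), Γ.self]
  let e := Equiv.ofBijective _ hb
  refine ⟨e.symm, fun i j => ?_⟩
  rw [key]
  exact congrArg₂ Γ.mult (e.apply_symm_apply i) (e.apply_symm_apply j)

theorem Connected.eq_univ (hc : Γ.Connected) {s : Set V} {v : V} (hv : v ∈ s)
    (h : ∀ a ∈ s, ∀ b, Γ.mult a b ≠ 0 → b ∈ s) (u : V) : u ∈ s := by
  obtain ⟨p⟩ := hc.preconnected v u
  induction p with
  | nil => exact hv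
  | cons e _ ih => exact ih (h _ hv _ (Γ.graph_adj.1 e))

/-- A positive definite diagram does not contain a simply laced diagram on which a non-zero vector
of natural numbers takes a non-positive value. -/
theorem not_forall_mult_ne_zero [DecidableEq V] (hΓ : Γ.symmMatrix.PosDef) {r : ℕ}
    {g : Fin r → V} (hg : Function.Injective g) (E : List (Fin r × Fin r)) (y : Fin r → ℕ)
    (hy : y ≠ 0) (hE : 2 * ∑ a, y a ^ 2 ≤
      ∑ a, ∑ b, (if (a, b) ∈ E ∨ (b, a) ∈ E then 1 else 0) * y a * y b) :
    ¬ ∀ e ∈ E, Γ.mult (g e.1) (g e.2) ≠ 0 := by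
  intro h
  have := pos_of_le_weight Γ hΓ hg
    (N := fun a b => ((if (a, b) ∈ E ∨ (b, a) ∈ E then 1 else 0 : ℕ) : ℝ))
    (y := fun a => (y a : ℝ)) ?_ (fun a => Nat.cast_nonneg _) ?_
  · rw [sub_pos] at this
    exact absurd (by exact_mod_cast this) (not_lt.2 hE)
  · intro a b
    split_ifs with hab
    · rw [Nat.cast_one]
      rcases hab with hab | hab
      · exact Γ.one_le_weight (h _ hab)
      · rw [weight_symm]
        exact Γ.one_le_weight (h _ hab)
    · rw [Nat.cast_zero]
      exact Γ.weight_nonneg _ _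
  · intro h0
    exact hy (funext fun a => by simpa using congrFun h0 a)

namespace IsLinePath

variable {n : ℕ} {f : ℕ → V}

theorem mult_eq_one [Fintype V] [DecidableEq V] (hΓ : Γ.symmMatrix.PosDef)
    (h : Γ.IsLinePath n f) {i j : ℕ} (hi : i + 1 < n) (hj : j + 1 < n) (hij : i ≠ j)
    (h2 : 2 ≤ Γ.mult (f i) (f (i + 1))) : Γ.mult (f j) (f (j + 1)) = 1 := by
  have h1 := h.adj j hj
  rcases hij.lt_or_gt with hlt | hlt
  · have := h.mult_add_mult_le_three hΓ hlt hj
    omega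
  · have := h.mult_add_mult_le_three hΓ hlt hi
    omega

theorem mult_eq_ite [Fintype V] [DecidableEq V] (hΓ : Γ.symmMatrix.PosDef)
    (h : Γ.IsLinePath n f) {i j : ℕ} (hij : i < j) (hj : j < n) :
    Γ.mult (f i) (f j) = if j = i + 1 then Γ.mult (f i) (f (i + 1)) else 0 := by
  split_ifs with he
  · rw [he]
  · exact h.mult_eq_zero hΓ (by omega) hj

/-- The chain of five vertices whose second line is double does not occur. -/
theorem not_affineF4 [DecidableEq V] (hΓ : Γ.symmMatrix.PosDef) (h : Γ.IsLinePath n f) {k : ℕ}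
    (hk : k + 4 < n) : Γ.mult (f (k + 1)) (f (k + 2)) ≠ 2 := by
  intro h2
  have hg : Function.Injective fun a : Fin 5 => f (k + a) := fun a b hab => by
    have := h.inj _ (by omega) _ (by omega) hab
    omega
  have e0 := Γ.one_le_weight (h.adj k (by omega))
  have e2 := Γ.one_le_weight (h.adj (k + 2) (by omega))
  have e3 := Γ.one_le_weight (h.adj (k + 3) (by omega))
  have e1 : Γ.weight (f (k + 1)) (f (k + 2)) = √2 := by rw [weight, h2]; norm_num
  have hs : √(2 : ℝ) * √2 = 2 := Real.mul_self_sqrt (by norm_num)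
  -- The vector satisfies Ny = 2y, so the form vanishes on it.
  have := pos_of_le_weight Γ hΓ hg (N := !![0, 1, 0, 0, 0; 1, 0, √2, 0, 0; 0, √2, 0, 1, 0;
    0, 0, 1, 0, 1; 0, 0, 0, 1, 0]) (y := ![√2, 2 * √2, 3, 2, 1]) ?_ ?_ ?_
  · simp [Fin.sum_univ_succ] at this
    nlinarith
  · intro a b
    fin_cases a <;> fin_cases b <;>
      first
      | exact Γ.weight_nonneg _ _
      | exact e0
      | exact e1.ge
      | exact e2
      | exact e3
      | (rw [weight_symm]; first | exact e0 | exact e1.ge | exact e2 | exact e3)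
  · intro a
    fin_cases a <;> simp
  · intro h0
    have := congrFun h0 2
    simp at this

/-- The bound on `k` says that the multiple line is not past the middle; reversing the path achieves
this. A double line at the end gives B/C, one elsewhere gives F4 or contains affine F4, and a triple
line tolerates no neighbouring line. -/
theorem isClassified_of_two_le_mult [Fintype V] [DecidableEq V] (hΓ : Γ.symmMatrix.PosDef)
    (h : Γ.IsLinePath n f) (hsurj : ∀ v, ∃ i < n, f i = v) {k : ℕ} (hk : 2 * k + 2 ≤ n)
    (hk2 : 2 ≤ Γ.mult (f k) (f (k + 1))) : Γ.IsClassified := by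
  have hone : ∀ i, i + 1 < n → i ≠ k → Γ.mult (f i) (f (i + 1)) = 1 := fun i hi hik =>
    h.mult_eq_one hΓ (by omega) hi hik.symm hk2
  have h3 := Γ.le_three (f k) (f (k + 1))
  rcases (by omega : Γ.mult (f k) (f (k + 1)) = 2 ∨ Γ.mult (f k) (f (k + 1)) = 3) with hm | hm
  · rcases Nat.eq_zero_or_pos k with rfl | hk0
    · refine Or.inr (Or.inl ⟨n, by omega, isomorphic_ofUpper f h.inj hsurj fun i j hij hj => ?_⟩)
      rw [h.mult_eq_ite hΓ hij hj]
      by_cases hi : i = 0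
      · subst hi
        simp [hm]
      · by_cases hj' : j = i + 1
        · simp [hj', hi, hone i (by omega) hi]
        · simp [hj']
    · rcases (by omega : n = 4 ∨ 4 < n) with rfl | hn
      · obtain rfl : k = 1 := by omega
        refine Or.inr (Or.inr (Or.inr (Or.inr (Or.inl
          (isomorphic_ofUpper f h.inj hsurj fun i j hij hj => ?_)))))
        rw [h.mult_eq_ite hΓ hij hj]
        by_cases hi : i = 1
        · subst hi
          simp [hm]
        · by_cases hj' : j = i + 1
          · simp [hj', hi, hone i (by omega) hi]
          · simp [hj']
      · refine (h.not_affineF4 hΓ (k := k - 1) (by omega) ?_).elim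
        rwa [show k - 1 + 1 = k by omega, show k - 1 + 2 = k + 1 by omega]
  · obtain rfl : n = 2 := by
      by_contra hn
      have := h.mult_add_le_three hΓ (i := k + 1) (j := k + 1) (a := k + 1) (b := k + 1)
        (u := f k) (v := f (k + 2)) (by omega)
        (h.not_mem_image (by omega) (by omega) (by omega))
        (h.not_mem_image (by omega) (by omega) (by omega))
        (fun e => by have := h.inj _ (by omega) _ (by omega) e; omega)
        le_rfl le_rfl le_rfl le_rfl
      have h1 := h.adj (k + 1) (by omega)
      rw [Γ.symm] at h1
      rw [hm] at this
      have : Γ.mult (f (k + 2)) (f (k + 1)) = 0 := by omega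
      exact h1 this
    obtain rfl : k = 0 := by omega
    refine Or.inr (Or.inr (Or.inr (Or.inr (Or.inr
      (isomorphic_ofUpper f h.inj hsurj fun i j hij hj => ?_)))))
    obtain rfl : i = 0 := by omega
    obtain rfl : j = 1 := by omega
    simpa using hm

theorem isClassified_of_surjective [Fintype V] [DecidableEq V] (hΓ : Γ.symmMatrix.PosDef)
    (h : Γ.IsLinePath n f) (hn : 1 ≤ n) (hsurj : ∀ v, ∃ i < n, f i = v) : Γ.IsClassified := by
  by_cases hall : ∀ i, i + 1 < n → Γ.mult (f i) (f (i + 1)) = 1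
  · refine Or.inl ⟨n, hn, isomorphic_ofUpper f h.inj hsurj fun i j hij hj => ?_⟩
    rw [h.mult_eq_ite hΓ hij hj]
    by_cases hj' : j = i + 1
    · simp [hj', hall i (by omega)]
    · simp [hj']
  · push Not at hall
    obtain ⟨k, hk, hk1⟩ := hall
    have hk0 := h.adj k hk
    have hk2 : 2 ≤ Γ.mult (f k) (f (k + 1)) := by omega
    rcases (by omega : 2 * k + 2 ≤ n ∨ 2 * (n - 2 - k) + 2 ≤ n) with hkn | hkn
    · exact h.isClassified_of_two_le_mult hΓ hsurj hkn hk2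
    · refine h.reverse.isClassified_of_two_le_mult hΓ (fun v => ?_) hkn ?_
      · obtain ⟨i, hi, rfl⟩ := hsurj v
        exact ⟨n - 1 - i, by omega, congrArg f (by omega)⟩
      · rwa [show n - 1 - (n - 2 - k) = k + 1 by omega,
          show n - 1 - (n - 2 - k + 1) = k by omega, Γ.symm]

/-- Next to an inner vertex `f k` of a path with a further neighbour `w`, all lines of the path
are simple, and `w` has no other neighbour on that side. -/
theorem branch_right [Fintype V] [DecidableEq V] (hΓ : Γ.symmMatrix.PosDef)
    (h : Γ.IsLinePath n f) {w : V} (hw : ∀ i < n, f i ≠ w) {k : ℕ} (hk0 : 0 < k) (hkn : k + 1 < n)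
    (hwk : Γ.mult w (f k) ≠ 0) :
    Γ.mult w (f k) = 1 ∧ (∀ j, k ≤ j → j + 1 < n → Γ.mult (f j) (f (j + 1)) = 1) ∧
      ∀ j, k < j → j < n → Γ.mult w (f j) = 0 := by
  have hw' : ∀ i j, j < n → w ∉ (Icc i j).image f := fun i j hj => by
    simp only [mem_image, mem_Icc, not_exists, not_and]
    exact fun a ha => hw a (by omega)
  have key : ∀ j, k ≤ j → j + 1 < n →
      Γ.mult w (f k) = 1 ∧ Γ.mult (f j) (f (j + 1)) = 1 := by
    intro j hkj hj
    -- Three lines leave the segment from `f k` to `f j`, so each of them is simple.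
    have := h.mult_add_add_le_three hΓ (i := k) (j := j) (a := k) (b := k) (c := j)
      (u := w) (v := f (k - 1)) (w := f (j + 1)) (by omega) (hw' _ _ (by omega))
      (h.not_mem_image (by omega) (by omega) (by omega))
      (h.not_mem_image (by omega) (by omega) (by omega))
      (hw _ (by omega)).symm (hw _ (by omega)).symm
      (fun e => by have := h.inj _ (by omega) _ (by omega) e; omega)
      le_rfl hkj le_rfl hkj hkj le_rfl
    have h1 := h.adj (k - 1) (by omega)
    have h2 := h.adj j hj
    rw [show k - 1 + 1 = k by omega] at h1
    rw [Γ.symm (f (j + 1))] at this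
    omega
  exact ⟨(key k le_rfl hkn).1, fun j hkj hj => (key j hkj hj).2, fun j hkj hj =>
    h.mult_eq_zero_of_mult_ne_zero hΓ hj (hw' k j hj) le_rfl hkj.le hkj.le le_rfl hkj.ne hwk⟩

theorem branch [Fintype V] [DecidableEq V] (hΓ : Γ.symmMatrix.PosDef)
    (h : Γ.IsLinePath n f) {w : V} (hw : ∀ i < n, f i ≠ w) {k : ℕ} (hk0 : 0 < k) (hkn : k + 1 < n)
    (hwk : Γ.mult w (f k) ≠ 0) :
    (∀ j, j + 1 < n → Γ.mult (f j) (f (j + 1)) = 1) ∧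
      ∀ j < n, Γ.mult w (f j) = if j = k then 1 else 0 := by
  obtain ⟨h1, h2, h3⟩ := h.branch_right hΓ hw hk0 hkn hwk
  obtain ⟨-, h2', h3'⟩ := h.reverse.branch_right hΓ (w := w) (fun i hi => hw _ (by omega))
    (k := n - 1 - k) (by omega) (by omega) (by rwa [show n - 1 - (n - 1 - k) = k by omega])
  refine ⟨fun j hj => ?_, fun j hj => ?_⟩
  · rcases Nat.lt_or_ge j k with hjk | hjk
    · have := h2' (n - 2 - j) (by omega) (by omega)
      rwa [show n - 1 - (n - 2 - j) = j + 1 by omega, show n - 1 - (n - 2 - j + 1) = j by omega,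
        Γ.symm] at this
    · exact h2 j hjk hj
  · rcases lt_trichotomy j k with hjk | rfl | hjk
    · have := h3' (n - 1 - j) (by omega) (by omega)
      rw [show n - 1 - (n - 1 - j) = j by omega] at this
      rw [this, if_neg hjk.ne]
    · rw [h1, if_pos rfl]
    · rw [h3 j hjk hj, if_neg hjk.ne']

/-- Otherwise four lines would leave the segment from `f k` to `f l`: those to w and x and the two
path lines at its ends. -/
theorem branch_unique [Fintype V] [DecidableEq V] (hΓ : Γ.symmMatrix.PosDef)
    (h : Γ.IsLinePath n f) {w x : V} (hw : ∀ i < n, f i ≠ w) (hx : ∀ i < n, f i ≠ x)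
    {k l : ℕ} (hk0 : 0 < k) (hkl : k ≤ l) (hln : l + 1 < n)
    (hwk : Γ.mult w (f k) ≠ 0) (hxl : Γ.mult x (f l) ≠ 0) : w = x := by
  by_contra hwx
  have out : ∀ u, (∀ i < n, f i ≠ u) → u ∉ (Icc k l).image f := fun u hu => by
    simp only [mem_image, mem_Icc, not_exists, not_and]
    exact fun a ha => hu a (by omega)
  have := h.mult_add_add_add_le_three hΓ (i := k) (j := l) (a := k) (b := l) (c := k) (d := l)
    (u := w) (v := x) (w := f (k - 1)) (x := f (l + 1)) (by omega) (out w hw) (out x hx)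
    (h.not_mem_image (by omega) (by omega) (by omega))
    (h.not_mem_image (by omega) (by omega) (by omega))
    hwx (hw _ (by omega)).symm (hw _ (by omega)).symm (hx _ (by omega)).symm
    (hx _ (by omega)).symm
    (fun e => by have := h.inj _ (by omega) _ (by omega) e; omega)
    le_rfl hkl hkl le_rfl le_rfl hkl hkl le_rfl
  have h1 := h.adj (k - 1) (by omega)
  have h2 := h.adj l hln
  rw [show k - 1 + 1 = k by omega] at h1
  rw [Γ.symm (f (l + 1))] at this
  omega

/-- The diagram with three arms of length two does not occur. -/
theorem not_affineE6 [DecidableEq V] (hΓ : Γ.symmMatrix.PosDef) (h : Γ.IsLinePath n f) {w u : V}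
    (hw : ∀ i < n, f i ≠ w) (hu : ∀ i < n, f i ≠ u) (hwu : w ≠ u) {k : ℕ} (hk : k + 4 < n)
    (hwk : Γ.mult w (f (k + 2)) ≠ 0) : Γ.mult u w = 0 := by
  by_contra huw
  have hg : Function.Injective fun a : Fin 7 =>
      if (a : ℕ) < 5 then f (k + a) else if (a : ℕ) = 5 then w else u := fun a b hab => by
    dsimp only at hab
    split_ifs at hab <;> first
      | exact (hw _ (by omega) hab).elim
      | exact (hw _ (by omega) hab.symm).elim
      | exact (hu _ (by omega) hab).elim
      | exact (hu _ (by omega) hab.symm).elim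
      | exact (hwu hab).elim
      | exact (hwu hab.symm).elim
      | omega
      | (have := h.inj _ (by omega) _ (by omega) hab; omega)
  -- The coefficients are the marks of the affine diagram: twice each mark is the sum of the marks
  -- of its neighbours, so the form vanishes. The same holds for E7 and E8 below.
  refine not_forall_mult_ne_zero hΓ hg [(0, 1), (1, 2), (2, 3), (3, 4), (5, 2), (6, 5)]
    ![1, 2, 3, 2, 1, 2, 1] (by decide) (by decide) ?_
  simp only [List.forall_mem_cons, List.not_mem_nil, false_imp_iff, implies_true, and_true]
  exact ⟨h.adj k (by omega), h.adj (k + 1) (by omega), h.adj (k + 2) (by omega),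
    h.adj (k + 3) (by omega), hwk, huw⟩

/-- The chain of seven vertices with a leaf at its centre does not occur. -/
theorem not_affineE7 [DecidableEq V] (hΓ : Γ.symmMatrix.PosDef) (h : Γ.IsLinePath n f) {w : V}
    (hw : ∀ i < n, f i ≠ w) {k : ℕ} (hk : k + 6 < n) : Γ.mult w (f (k + 3)) = 0 := by
  by_contra hwk
  have hg : Function.Injective fun a : Fin 8 => if (a : ℕ) < 7 then f (k + a) else w :=
    fun a b hab => by
      dsimp only at hab
      split_ifs at hab <;> first
        | exact (hw _ (by omega) hab).elim
        | exact (hw _ (by omega) hab.symm).elim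
        | omega
        | (have := h.inj _ (by omega) _ (by omega) hab; omega)
  refine not_forall_mult_ne_zero hΓ hg [(0, 1), (1, 2), (2, 3), (3, 4), (4, 5), (5, 6), (7, 3)]
    ![1, 2, 3, 4, 3, 2, 1, 2] (by decide) (by decide) ?_
  simp only [List.forall_mem_cons, List.not_mem_nil, false_imp_iff, implies_true, and_true]
  exact ⟨h.adj k (by omega), h.adj (k + 1) (by omega), h.adj (k + 2) (by omega),
    h.adj (k + 3) (by omega), h.adj (k + 4) (by omega), h.adj (k + 5) (by omega), hwk⟩

/-- The chain of eight vertices with a leaf at its third vertex does not occur. -/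
theorem not_affineE8 [DecidableEq V] (hΓ : Γ.symmMatrix.PosDef) (h : Γ.IsLinePath n f) {w : V}
    (hw : ∀ i < n, f i ≠ w) {k : ℕ} (hk : k + 7 < n) : Γ.mult w (f (k + 2)) = 0 := by
  by_contra hwk
  have hg : Function.Injective fun a : Fin 9 => if (a : ℕ) < 8 then f (k + a) else w :=
    fun a b hab => by
      dsimp only at hab
      split_ifs at hab <;> first
        | exact (hw _ (by omega) hab).elim
        | exact (hw _ (by omega) hab.symm).elim
        | omega
        | (have := h.inj _ (by omega) _ (by omega) hab; omega)
  refine not_forall_mult_ne_zero hΓ hg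
    [(0, 1), (1, 2), (2, 3), (3, 4), (4, 5), (5, 6), (6, 7), (8, 2)]
    ![2, 4, 6, 5, 4, 3, 2, 1, 3] (by decide) (by decide) ?_
  simp only [List.forall_mem_cons, List.not_mem_nil, false_imp_iff, implies_true, and_true]
  exact ⟨h.adj k (by omega), h.adj (k + 1) (by omega), h.adj (k + 2) (by omega),
    h.adj (k + 3) (by omega), h.adj (k + 4) (by omega), h.adj (k + 5) (by omega),
    h.adj (k + 6) (by omega), hwk⟩

/-- The arms at `f k` have lengths 1, `k` and `n - 1 - k`, with `k` at most the last. Length `k = 1`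
gives D, `k = 2` gives E with `n ≤ 7` by affine E8, and `k ≥ 3` contains affine E7. -/
theorem isClassified_of_leaf [Fintype V] [DecidableEq V] (hΓ : Γ.symmMatrix.PosDef)
    (h : Γ.IsLinePath n f) {w : V} (hw : ∀ i < n, f i ≠ w)
    (hsurj : ∀ v, v = w ∨ ∃ i < n, f i = v) {k : ℕ} (hk0 : 0 < k) (hkn : 2 * k + 1 ≤ n)
    (hwk : Γ.mult w (f k) ≠ 0) : Γ.IsClassified := by
  obtain ⟨h1, h2⟩ := h.branch hΓ hw hk0 (by omega) hwk
  have h3 : ∀ i j, i < j → j < n → Γ.mult (f i) (f j) = if j = i + 1 then 1 else 0 := by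
    intro i j hij hj
    rw [h.mult_eq_ite hΓ hij hj]
    split_ifs with he
    · exact h1 i (by omega)
    · rfl
  -- Inserting `w` just before the branch vertex matches the numbering of `typeD` for `k = 1` and of
  -- `typeE` for `k = 2`.
  set g : ℕ → V := fun i => if i < k then f i else if i = k then w else f (i - 1) with hg
  have ginj : ∀ i < n + 1, ∀ j < n + 1, g i = g j → i = j := by
    intro i hi j hj hij
    simp only [g] at hij
    split_ifs at hij <;> first
      | exact (hw _ (by omega) hij).elim
      | exact (hw _ (by omega) hij.symm).elim
      | omega
      | (have := h.inj _ (by omega) _ (by omega) hij; omega)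
  have gsurj : ∀ v, ∃ i < n + 1, g i = v := by
    intro v
    rcases hsurj v with rfl | ⟨i, hi, rfl⟩
    · exact ⟨k, by omega, by simp [g]⟩
    · rcases Nat.lt_or_ge i k with hik | hik
      · exact ⟨i, by omega, by simp [g, hik]⟩
      · refine ⟨i + 1, by omega, ?_⟩
        simp only [g]
        rw [if_neg (by omega), if_neg (by omega), Nat.add_sub_cancel]
  have gmult : ∀ i j, i < j → j < n + 1 → Γ.mult (g i) (g j) =
      if (j < k ∧ j = i + 1) ∨ (i < k ∧ k < j ∧ j = i + 2) ∨ (i = k ∧ j = k + 1) ∨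
        (k < i ∧ j = i + 1) then 1 else 0 := by
    intro i j hij hj
    simp only [g]
    rcases lt_trichotomy i k with hik | hik | hik
    · rcases lt_trichotomy j k with hjk | hjk | hjk
      · rw [if_pos hik, if_pos hjk, h3 i j hij (by omega)]
        exact if_congr (by omega) rfl rfl
      · rw [if_pos hik, if_neg (by omega), if_pos hjk, Γ.symm, h2 i (by omega)]
        exact if_congr (by omega) rfl rfl
      · rw [if_pos hik, if_neg (by omega), if_neg (by omega), h3 i (j - 1) (by omega) (by omega)]
        exact if_congr (by omega) rfl rfl
    · rw [if_neg (by omega), if_pos hik, if_neg (by omega), if_neg (by omega),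
        h2 (j - 1) (by omega)]
      exact if_congr (by omega) rfl rfl
    · rw [if_neg (by omega), if_neg (by omega), if_neg (by omega), if_neg (by omega),
        h3 (i - 1) (j - 1) (by omega) (by omega)]
      exact if_congr (by omega) rfl rfl
  rcases (by omega : k = 1 ∨ k = 2 ∨ 3 ≤ k) with rfl | rfl | hk3
  · refine Or.inr (Or.inr (Or.inl ⟨n + 1, by omega,
      isomorphic_ofUpper g ginj gsurj fun i j hij hj => ?_⟩))
    rw [gmult i j hij hj]
    exact if_congr (by omega) rfl rfl
  · have hn8 : n ≤ 7 := by
      by_contra hn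
      exact hwk (h.not_affineE8 hΓ hw (k := 0) (by omega))
    refine Or.inr (Or.inr (Or.inr (Or.inl ⟨n + 1, by omega, by omega,
      isomorphic_ofUpper g ginj gsurj fun i j hij hj => ?_⟩)))
    rw [gmult i j hij hj]
    exact if_congr (by omega) rfl rfl
  · refine (hwk ?_).elim
    have := h.not_affineE7 hΓ hw (k := k - 3) (by omega)
    rwa [show k - 3 + 3 = k by omega] at this

theorem le_card [Fintype V] (h : Γ.IsLinePath n f) : n ≤ Fintype.card V := by
  have := Fintype.card_le_of_injective (fun i : Fin n => f i)
    fun i j hij => Fin.ext (h.inj i i.2 j j.2 hij)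
  simpa using this

/-- A neighbour of a longest path is joined to one of its inner vertices. -/
theorem pos_of_maximal (h : Γ.IsLinePath n f) (hmax : ∀ m g, Γ.IsLinePath m g → m ≤ n) {w : V}
    (hw : ∀ i < n, f i ≠ w) {k : ℕ} (hwk : Γ.mult w (f k) ≠ 0) : 0 < k := by
  by_contra hk
  obtain rfl : k = 0 := by omega
  have := hmax _ _ (h.cons hw hwk)
  omega

/-- The path u, w, `f k`, …, `f (n - 1)` has `n - k + 2` vertices, at most `n` by maximality. -/
theorem two_le_of_maximal (h : Γ.IsLinePath n f) (hmax : ∀ m g, Γ.IsLinePath m g → m ≤ n)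
    {w u : V} (hw : ∀ i < n, f i ≠ w) (hu : ∀ i < n, f i ≠ u) (hwu : w ≠ u) {k : ℕ} (hk : k < n)
    (hwk : Γ.mult w (f k) ≠ 0) (huw : Γ.mult u w ≠ 0) : 2 ≤ k := by
  have h1 := (h.drop (m := n - k) k (by omega)).cons (w := w) (fun i hi => hw _ (by omega))
    (by simpa using hwk)
  have h2 := h1.cons (w := u) (fun i hi => by
    split_ifs
    · exact hwu
    · exact hu _ (by omega)) (by simpa using huw)
  have := hmax _ _ h2
  omega

end IsLinePath

theorem isClassified_of_posDef [Fintype V] [DecidableEq V] (hc : Γ.Connected)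
    (hΓ : Γ.symmMatrix.PosDef) : Γ.IsClassified := by
  classical
  obtain ⟨v₀⟩ := hc.nonempty
  have h1 : Γ.IsLinePath 1 fun _ => v₀ := ⟨fun i hi j hj _ => by omega, fun i hi => by omega⟩
  let p : ℕ → Prop := fun n => ∃ f, Γ.IsLinePath n f
  have hp1 : p 1 := ⟨_, h1⟩
  have hle : ∀ {m}, p m → m ≤ Fintype.card V := fun ⟨_, hg⟩ => hg.le_card
  obtain ⟨f, h⟩ : p (Nat.findGreatest p (Fintype.card V)) := Nat.findGreatest_spec (hle hp1) hp1
  set n := Nat.findGreatest p (Fintype.card V)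
  have hmax : ∀ m g, Γ.IsLinePath m g → m ≤ n := fun m g hg =>
    Nat.le_findGreatest (hle ⟨g, hg⟩) ⟨g, hg⟩
  have hn : 1 ≤ n := hmax _ _ h1
  by_cases hsurj : ∀ v, ∃ i < n, f i = v
  · exact h.isClassified_of_surjective hΓ hn hsurj
  obtain ⟨w, hw, k, hk, hwk⟩ : ∃ w, (∀ i < n, f i ≠ w) ∧ ∃ k < n, Γ.mult w (f k) ≠ 0 := by
    by_contra hcon
    push Not at hcon
    refine hsurj fun v => hc.eq_univ (s := {v | ∃ i < n, f i = v}) ⟨0, hn, rfl⟩ ?_ v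
    rintro _ ⟨i, hi, rfl⟩ b hb
    by_contra hb'
    refine hb ?_
    rw [Γ.symm]
    exact hcon b (fun j hj e => hb' ⟨j, hj, e⟩) i hi
  have inner : ∀ x, (∀ i < n, f i ≠ x) → ∀ j < n, Γ.mult x (f j) ≠ 0 → 0 < j ∧ j + 1 < n := by
    intro x hx j hj hxj
    have := h.reverse.pos_of_maximal hmax (w := x) (fun i hi => hx _ (by omega))
      (k := n - 1 - j) (by rwa [show n - 1 - (n - 1 - j) = j by omega])
    exact ⟨h.pos_of_maximal hmax hx hxj, by omega⟩
  have hkk := inner w hw k hk hwk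
  -- A further vertex b joined to `w` would make all three arms at `f k` of length at least 2, hence
  -- give affine E6; one joined to the path would contradict `branch_unique`.
  have hcover : ∀ v, v = w ∨ ∃ i < n, f i = v := by
    refine hc.eq_univ (s := {v | v = w ∨ ∃ i < n, f i = v}) (v := w) (Or.inl rfl) ?_
    intro a ha b hab
    by_contra hb
    simp only [Set.mem_ofPred_eq, not_or, not_exists, not_and] at hb
    obtain ⟨hbw, hbf⟩ := hb
    rw [Γ.symm] at hab
    rcases ha with rfl | ⟨i, hi, rfl⟩
    · have e1 := h.two_le_of_maximal hmax hw hbf (Ne.symm hbw) hk hwk hab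
      have e2 := h.reverse.two_le_of_maximal hmax (w := a) (u := b)
        (fun i hi => hw _ (by omega)) (fun i hi => hbf _ (by omega)) (Ne.symm hbw)
        (k := n - 1 - k) (by omega) (by rwa [show n - 1 - (n - 1 - k) = k by omega]) hab
      refine hab (h.not_affineE6 hΓ hw hbf (Ne.symm hbw) (k := k - 2) (by omega) ?_)
      rwa [show k - 2 + 2 = k by omega]
    · have hii := inner b hbf i hi hab
      rcases le_total k i with hki | hki
      · exact hbw (h.branch_unique hΓ hw hbf hkk.1 hki hii.2 hwk hab).symm
      · exact hbw (h.branch_unique hΓ hbf hw hii.1 hki hkk.2 hab hwk)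
  -- The path is oriented so that its shorter arm comes first.
  rcases (by omega : 2 * k + 1 ≤ n ∨ 2 * (n - 1 - k) + 1 ≤ n) with hkn | hkn
  · exact h.isClassified_of_leaf hΓ hw hcover hkk.1 hkn hwk
  · refine h.reverse.isClassified_of_leaf hΓ (w := w) (fun i hi => hw _ (by omega)) (fun v => ?_)
      (k := n - 1 - k) (by omega) hkn (by rwa [show n - 1 - (n - 1 - k) = k by omega])
    refine (hcover v).imp id ?_
    rintro ⟨i, hi, rfl⟩
    exact ⟨n - 1 - i, by omega, congrArg f (by omega)⟩

end Classification

end CoxeterDiagram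

theorem mainTheorem2 {V : Type*} [Fintype V] [DecidableEq V] (Γ : CoxeterDiagram V) :
    (Γ.Connected ∧ Γ.IsPosDef ↔ Γ.IsClassified) ∧
      (Γ.Connected ∧ Γ.symmMatrix.PosDef ↔ Γ.IsClassified) := by
  refine ⟨⟨fun h => CoxeterDiagram.isClassified_of_posDef h.1
      (CoxeterDiagram.symmMatrix_posDef_of_isPosDef h.2), fun h => ?_⟩,
    ⟨fun h => CoxeterDiagram.isClassified_of_posDef h.1 h.2, fun h => ?_⟩⟩
  · obtain ⟨hc, hs, hp⟩ := h.connected_symmetrised_posDef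
    exact ⟨hc, CoxeterDiagram.isPosDef_of_symmMatrix hs hp⟩
  · obtain ⟨hc, -, hp⟩ := h.connected_symmetrised_posDef
    exact ⟨hc, hp⟩
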